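/- Let $s,t>1$ be odd and coprime, and put $p=\frac{s-1}{2}$, $q=\frac{t-1}{2}$. A self-conjugate $(s,t)$-core is a self-conjugate partition none of whose hook lengths equals $s$ or $t$; an $(\bar s,\bar t)$-core is a partition with distinct parts none of whose bar lengths equals $s$ or $t$. (The bar lengths of a partition $\lambda$ with distinct parts are the hook lengths, in its shift-symmetric diagram, of the boxes of its shifted Young diagram. The shifted diagram $S(\lambda)$ is obtained by shifting the $i$-th row of the Young diagram $i-1$ boxes to the right, and the shift-symmetric diagram by attaching to $S(\lambda)$, for each $i$, a column of $\lambda_i$ boxes whose top box is immediately to the left of the box $(i,i)$ of $S(\lambda)$.) The diagonal hooks diagram is the $p\times q$ array (matrix notation, $1\le i\le p$, $1\le j\le q$) with entry $st-s(2j-1)-t(2i-1)$ in position $(i,j)$. For the Yin-Yang diagram, consider the array with entry $st-s-t-\alpha s-\beta t$ in column $\alpha\ge 0$ and row $\beta\ge 0$. The Yin rectangle consists of rows $p,\dots,2p-1$ and columns $0,\dots,q-1$; the Yang rectangle consists of rows $0,\dots,p-1$ and columns $q,\dots,2q-1$ and is rotated by $180^\circ$. The Yin-Yang diagram is the $p\times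 q$ array whose entry in each position is the entry of the Yin rectangle if that is positive, and otherwise minus the entry of the rotated Yang rectangle. Its entry in position $(i,j)$ is thus $t\left(\frac{s+1}{2}-i\right)-sj$. A monotone path is a lattice path with unit steps up and right from the bottom left to the top right corner of a $p\times q$ array of boxes. In each of the two diagrams there is a monotone path, called the border, that has exactly the positive entries on its upper left side and exactly the negative entries on its lower right side. The values trapped between a monotone path $\pi$ and the border are the absolute values of the entries in the boxes that lie on different sides of the two paths. Then: 1. there is a bijection $\pi\mapsto\lambda^*_\pi$ from the monotone paths onto the self-conjugate $(s,t)$-cores such that the set of diagonal hook lengths of $\lambda^*_\pi$ is the set of values trapped between $\pi$ and the border of the diagonal hooks diagram; 2. there is a bijection $\pi\mapsto\bar\lambda_\pi$ from the monotone paths onto the $(\bar s,\bar t)$-cores such that the set of parts of $\bar\lambda_\pi$ is the set of values trapped between $\pi$ and the border of the Yin-Yang diagram; 3. there is a bijection $\gamma$ from the set of self-conjugate $(s,t)$-cores onto the set of $(\bar s,\bar t)$-cores with $\gamma(\lambda^*_\pi)=\bar\lambda_\pi$ for every monotone path $\pi$. -/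

import Mathlib

/- Partitions are Mathlib's Young diagrams (English convention, rows and columns numbered from 0;
the row lengths are the parts, and the empty diagram is the partition of zero). -/

/-- The number of boxes of the hook with corner `c` in a finite set `D` of boxes: the boxes of `D`
weakly to the right of `c` in its row, or weakly below `c` in its column. -/
def hookLength (D : Finset (ℕ × ℕ)) (c : ℕ × ℕ) : ℕ :=
  (D.filter fun d => (d.1 = c.1 ∧ c.2 ≤ d.2) ∨ (d.2 = c.2 ∧ c.1 ≤ d.1)).card

/-- A `t`-core partition: no hook has length `t`. -/
def IsCorePartition (t : ℕ) (μ : YoungDiagram) : Prop :=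
  ∀ c ∈ μ.cells, hookLength μ.cells c ≠ t

/-- Self-conjugate partitions that are both `s`-cores and `t`-cores. -/
def SelfConjCore (s t : ℕ) : Type :=
  {μ : YoungDiagram // μ.transpose = μ ∧ IsCorePartition s μ ∧ IsCorePartition t μ}

/-- The set of diagonal hook lengths of a partition. -/
def diagHookLengths (μ : YoungDiagram) : Set ℕ :=
  {h | ∃ i : ℕ, (i, i) ∈ μ.cells ∧ h = hookLength μ.cells (i, i)}

/-- The set of parts of a partition. -/
def partSet (μ : YoungDiagram) : Set ℕ := {n | n ∈ μ.rowLens}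

/-- A bar partition: all parts are distinct. -/
def IsBarPartition (μ : YoungDiagram) : Prop := μ.rowLens.Nodup

/-- The shift-symmetric diagram. The box `(i, j)` of the partition sits at `(i, i + j)` in the
shifted diagram, hence at `(i, i + j + 1)` here, because one more column is attached on the left;
for each `i`, a column with as many boxes as the `i`-th part has is placed at `(i, i)` and below,
that is, immediately to the left of the diagonal box of the shifted diagram. -/
def shiftSymmetric (μ : YoungDiagram) : Finset (ℕ × ℕ) :=
  μ.cells.image (fun c => (c.1, c.1 + c.2 + 1)) ∪ μ.cells.image (fun c => (c.1 + c.2, c.1))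

/-- The bar length of a box of a bar partition: the hook length, in the shift-symmetric diagram,
of the corresponding box of the shifted diagram. -/
def barLength (μ : YoungDiagram) (c : ℕ × ℕ) : ℕ :=
  hookLength (shiftSymmetric μ) (c.1, c.1 + c.2 + 1)

/-- No bar has length `t`. -/
def HasNoBar (t : ℕ) (μ : YoungDiagram) : Prop :=
  ∀ c ∈ μ.cells, barLength μ c ≠ t

/-- Bar partitions that are both `s`-bar-cores and `t`-bar-cores. -/
def BarCore (s t : ℕ) : Type :=
  {μ : YoungDiagram // IsBarPartition μ ∧ HasNoBar s μ ∧ HasNoBar t μ}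

/-- A unit step of a monotone lattice path. -/
inductive LatticeStep where
  | up
  | right
  deriving DecidableEq

/-- Monotone lattice paths from the bottom left to the top right corner of an array of boxes with
`p` rows and `q` columns, given by their sequence of steps. -/
def LatticePath (p q : ℕ) : Type :=
  {w : List LatticeStep // w.count LatticeStep.up = p ∧ w.count LatticeStep.right = q}

/-- The box in row `i` (from the top) and column `j` (from the left), numbered from 0, lies on the
upper left side of the path: some vertex of the path is weakly to the right of and weakly below the
bottom right corner of the box, which is `j + 1` to the right of and `p - (i + 1)` above the start
of the path. The vertices of the path are the end points of its initial segments `u`. -/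
def UpperLeft {p q : ℕ} (π : LatticePath p q) (i : Fin p) (j : Fin q) : Prop :=
  ∃ u : List LatticeStep, u <+: π.1 ∧
    (j : ℕ) + 1 ≤ u.count LatticeStep.right ∧ u.count LatticeStep.up + ((i : ℕ) + 1) ≤ p

/-- The path separates the positive entries of the array (on its upper left side) from the negative
ones (on its lower right side). -/
def IsBorder {p q : ℕ} (D : Fin p → Fin q → ℤ) (β : LatticePath p q) : Prop :=
  ∀ i j, (UpperLeft β i j → 0 < D i j) ∧ (¬ UpperLeft β i j → D i j < 0)

/-- The absolute values of the entries of the array `D` in the boxes trapped between the paths `π`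
and `β`, i.e. the boxes that are on different sides of the two paths. -/
def trappedValues {p q : ℕ} (D : Fin p → Fin q → ℤ) (π β : LatticePath p q) : Set ℕ :=
  {n | ∃ i j, ¬ (UpperLeft π i j ↔ UpperLeft β i j) ∧ n = (D i j).natAbs}

/-- The diagonal hooks diagram. (With rows and columns numbered from 1 instead, its entry is
`s * t - s * (2 * j - 1) - t * (2 * i - 1)`.) -/
def diagHooksDiagram (s t : ℕ) (i : Fin (s / 2)) (j : Fin (t / 2)) : ℤ :=
  (s : ℤ) * t - s * (2 * (j : ℤ) + 1) - t * (2 * (i : ℤ) + 1)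

/-- The array of possible parts of bar cores: it has `s * t - s - t` in its upper left corner,
decreases by `s` with every move to the right and by `t` with every move down. -/
def barPartArray (s t : ℕ) (row col : ℕ) : ℤ :=
  (s : ℤ) * t - s - t - col * s - row * t

/-- The rectangle immediately below the upper left `(s / 2) × (t / 2)` rectangle of
`barPartArray`; its positive entries form the Yin part. -/
def yin (s t : ℕ) (i : Fin (s / 2)) (j : Fin (t / 2)) : ℤ :=
  barPartArray s t (s / 2 + i) j

/-- The rectangle immediately to the right of the upper left `(s / 2) × (t / 2)` rectangle of
`barPartArray`, rotated by 180 degrees; its positive entries form the Yang part. -/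
def yang (s t : ℕ) (i : Fin (s / 2)) (j : Fin (t / 2)) : ℤ :=
  barPartArray s t i.rev (t / 2 + j.rev)

/-- The Yin-Yang diagram: the rotated Yang part is attached to the Yin part. The entries of the
Yang part carry a negative sign. -/
def yinYangDiagram (s t : ℕ) (i : Fin (s / 2)) (j : Fin (t / 2)) : ℤ :=
  if 0 < yin s t i j then yin s t i j else -yang s t i j

/-!
Both families of cores are encoded by finite sets `H` of positive integers: a self-conjugate
partition by the set of its diagonal hook lengths, which are odd, and a bar partition by the set of
its parts. Extend `H` to the set `M` of integers (`SymExt`) that contains `0` and exactly one of `n`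
and `-n`, for `n ≠ 0`. Then the core conditions for `s` and `t` say that `M` is closed under
subtraction of `S` and `T`, where `(S, T) = (2s, 2t)` for self-conjugate cores and `(S, T) = (s, t)`
for bar cores; on `H` itself, this is `BarClosed`. For self-conjugate partitions this is the
description of hook lengths by the bead set (`YoungDiagram.isCorePartition_iff_barClosed`), and for
bar partitions it follows from the same description for the shift-symmetric diagram, the Young
diagram with arms `λ_i` and legs `λ_i - 1` in Frobenius' notation
(`YoungDiagram.hasNoBar_iff_barClosed`).

Arrange the integers that can occur in `M` in a two-dimensional array whose entries decrease by `S`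
to the right and by `T` downwards. The steps preserve membership in `M`, so the complement of `M` is
closed under steps to the left and up, and its intersection with the `p × q` rectangle is the upper
left side of a unique monotone path. For `H` empty, `M` consists of the nonpositive integers, and
the path is the border. So a box of the rectangle is trapped if and only if the absolute value of
its entry belongs to `H`. Since `s` and `t` are coprime, these absolute values are distinct.
Conversely, since `M` is antisymmetric and closed under the steps, it is determined outside the
rectangle and its rotated image: every element of `H` is the absolute value of an entry of the
rectangle (`exists_natAbs_hookBarArray_eq`), and the trapped set of an arbitrary path is `BarClosed`
(`barClosed_trappedSet`). So the trapped sets of paths are exactly the sets `H` of cores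
(`IsTrapArray.range_trappedSet_side`).

Twice the Yin-Yang diagram and the diagonal hooks diagram are the two cases `ε = 1` and `ε = 0` of
one array, `hookBarArray`, and the arithmetic is carried out for both at once.
-/

/-! ### Monotone paths and lower sets -/

/-- The boxes on the upper left side of a word of steps, in an array with `p` rows; this is
`UpperLeft` without the constraint on the numbers of steps. -/
def WordUpperLeft (p : ℕ) (w : List LatticeStep) (i j : ℕ) : Prop :=
  ∃ u : List LatticeStep, u <+: w ∧
    j + 1 ≤ u.count LatticeStep.right ∧ u.count LatticeStep.up + (i + 1) ≤ p

theorem wordUpperLeft_right_zero {p i : ℕ} (w : List LatticeStep) (hi : i < p) :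
    WordUpperLeft p (LatticeStep.right :: w) i 0 :=
  ⟨[LatticeStep.right], by simp, by simp, by simpa using hi⟩

theorem wordUpperLeft_right_succ (p i j : ℕ) (w : List LatticeStep) :
    WordUpperLeft p (LatticeStep.right :: w) i (j + 1) ↔ WordUpperLeft p w i j := by
  constructor
  · rintro ⟨u, hu, h1, h2⟩
    rcases List.prefix_cons_iff.1 hu with rfl | ⟨v, rfl, hv⟩
    · simp at h1
    · exact ⟨v, hv, by simpa using h1, by simpa using h2⟩
  · rintro ⟨v, hv, h1, h2⟩
    exact ⟨LatticeStep.right :: v, by simpa using hv, by simpa using h1, by simpa using h2⟩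

theorem wordUpperLeft_up (p i j : ℕ) (w : List LatticeStep) :
    WordUpperLeft (p + 1) (LatticeStep.up :: w) i j ↔ WordUpperLeft p w i j := by
  constructor
  · rintro ⟨u, hu, h1, h2⟩
    rcases List.prefix_cons_iff.1 hu with rfl | ⟨v, rfl, hv⟩
    · simp at h1
    · refine ⟨v, hv, by simpa using h1, ?_⟩
      simp at h2
      omega
  · rintro ⟨v, hv, h1, h2⟩
    refine ⟨LatticeStep.up :: v, by simpa using hv, by simpa using h1, ?_⟩
    simp
    omega

theorem WordUpperLeft.lt {p : ℕ} {w : List LatticeStep} {i j : ℕ} (h : WordUpperLeft p w i j) :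
    i < p := by
  obtain ⟨u, -, -, h⟩ := h
  omega

theorem WordUpperLeft.mono {p : ℕ} {w : List LatticeStep} {i j i' j' : ℕ}
    (h : WordUpperLeft p w i j) (hi : i' ≤ i) (hj : j' ≤ j) : WordUpperLeft p w i' j' := by
  obtain ⟨u, hu, h1, h2⟩ := h
  exact ⟨u, hu, by omega, by omega⟩

/-- The first step is determined by the bottom left box. -/
theorem word_ext (p q : ℕ) (w w' : List LatticeStep)
    (hp : w.count LatticeStep.up = p) (hq : w.count LatticeStep.right = q)
    (hp' : w'.count LatticeStep.up = p) (hq' : w'.count LatticeStep.right = q)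
    (h : ∀ i < p, ∀ j < q, WordUpperLeft p w i j ↔ WordUpperLeft p w' i j) : w = w' := by
  induction w generalizing p q w' with
  | nil =>
    cases w' with
    | nil => rfl
    | cons a w' => cases a <;> simp at hp hq hp' hq' <;> omega
  | cons a w ih =>
    cases w' with
    | nil => cases a <;> simp at hp hq hp' hq' <;> omega
    | cons b w' =>
      cases a <;> cases b
      · obtain ⟨p, rfl⟩ : ∃ r, p = r + 1 := ⟨_, by simpa using hp.symm⟩
        simp only [wordUpperLeft_up] at h
        rw [ih p q w' (by simpa using hp) (by simpa using hq) (by simpa using hp')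
          (by simpa using hq') fun i hi j hj => h i (by omega) j hj]
      · obtain ⟨p, rfl⟩ : ∃ r, p = r + 1 := ⟨_, by simpa using hp.symm⟩
        have hq0 : 0 < q := by simp at hq'; omega
        have := (h p (by omega) 0 hq0).2 (wordUpperLeft_right_zero _ (by omega))
        rw [wordUpperLeft_up] at this
        exact absurd this.lt (by omega)
      · obtain ⟨p, rfl⟩ : ∃ r, p = r + 1 := ⟨_, by simpa using hp'.symm⟩
        have hq0 : 0 < q := by simp at hq; omega
        have := (h p (by omega) 0 hq0).1 (wordUpperLeft_right_zero _ (by omega))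
        rw [wordUpperLeft_up] at this
        exact absurd this.lt (by omega)
      · obtain ⟨q, rfl⟩ : ∃ r, q = r + 1 := ⟨_, by simpa using hq.symm⟩
        rw [ih p q w' (by simpa using hp) (by simpa using hq) (by simpa using hp')
          (by simpa using hq') fun i hi j hj => by
            simpa only [wordUpperLeft_right_succ] using h i hi (j + 1) (by omega)]

/-- The word starts with a step to the right if the bottom left box belongs to the lower set (the
whole first column then does), and with a step up if it does not (no box of the last row does). -/
theorem exists_word (p q : ℕ) (U : ℕ → ℕ → Prop)
    (hU : ∀ i j i' j', i < p → j < q → i' ≤ i → j' ≤ j → U i j → U i' j') :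
    ∃ w : List LatticeStep, w.count LatticeStep.up = p ∧ w.count LatticeStep.right = q ∧
      ∀ i < p, ∀ j < q, WordUpperLeft p w i j ↔ U i j := by
  induction p generalizing q U with
  | zero =>
    refine ⟨List.replicate q LatticeStep.right, ?_, by simp, fun i hi => by omega⟩
    simp [List.count_replicate]
  | succ p ihp =>
    induction q generalizing U with
    | zero =>
      refine ⟨List.replicate (p + 1) LatticeStep.up, by simp, ?_, fun i _ j hj => by omega⟩
      simp [List.count_replicate]
    | succ q ihq =>
      by_cases h0 : U p 0
      · obtain ⟨w, h1, h2, h3⟩ := ihq (fun i j => U i (j + 1))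
          fun i j i' j' hi hj hi' hj' h => hU _ _ _ _ hi (by omega) hi' (by omega) h
        refine ⟨LatticeStep.right :: w, by simpa using h1, by simpa using h2, fun i hi j hj => ?_⟩
        rcases j with _ | j
        · exact iff_of_true (wordUpperLeft_right_zero _ hi)
            (hU p 0 i 0 (by omega) (by omega) (by omega) le_rfl h0)
        · rw [wordUpperLeft_right_succ, h3 i hi j (by omega)]
      · obtain ⟨w, h1, h2, h3⟩ := ihp (q + 1) U
          fun i j i' j' hi hj hi' hj' h => hU _ _ _ _ (by omega) hj hi' hj' h
        refine ⟨LatticeStep.up :: w, by simpa using h1, by simpa using h2, fun i hi j hj => ?_⟩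
        rw [wordUpperLeft_up]
        rcases Nat.lt_succ_iff_lt_or_eq.1 hi with hi | rfl
        · exact h3 i hi j hj
        · exact iff_of_false (fun h => absurd h.lt (by omega))
            fun h => h0 (hU i j i 0 (by omega) hj le_rfl (by omega) h)

theorem latticePath_ext {p q : ℕ} {π π' : LatticePath p q}
    (h : ∀ (i : Fin p) (j : Fin q), UpperLeft π i j ↔ UpperLeft π' i j) : π = π' :=
  Subtype.ext <| word_ext p q π.1 π'.1 π.2.1 π.2.2 π'.2.1 π'.2.2
    fun i hi j hj => h ⟨i, hi⟩ ⟨j, hj⟩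

theorem exists_latticePath {p q : ℕ} (U : ℕ → ℕ → Prop)
    (hU : ∀ i j i' j', i < p → j < q → i' ≤ i → j' ≤ j → U i j → U i' j') :
    ∃ π : LatticePath p q, ∀ (i : Fin p) (j : Fin q), UpperLeft π i j ↔ U i j := by
  obtain ⟨w, h1, h2, h3⟩ := exists_word p q U hU
  exact ⟨⟨w, h1, h2⟩, fun i j => h3 i i.2 j j.2⟩

/-! ### Bar closed sets and trapped values -/

/-- The condition that no bar has length `S`, for a bar partition with set of parts `H`: no part
equals `S`, the difference of `S` and a larger part is a part, and no two parts add up to `S`. (For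
odd `S`, two such parts are different.) -/
def BarClosed (S : ℕ) (H : Set ℕ) : Prop :=
  ∀ h ∈ H, h ≠ S ∧ (S < h → h - S ∈ H) ∧ (h < S → S - h ∉ H)

/-- The extension of a set of positive integers to the set `M` of integers with `n ∈ M` if and only
if `-n ∉ M`, for all `n ≠ 0`. If `0 ∉ H`, then `M` contains `0`. -/
def SymExt (H : Set ℕ) (n : ℤ) : Prop := if 0 < n then n.natAbs ∈ H else n.natAbs ∉ H

theorem symExt_of_pos {H : Set ℕ} {n : ℤ} (hn : 0 < n) : SymExt H n ↔ n.natAbs ∈ H := by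
  simp [SymExt, hn]

theorem symExt_of_nonpos {H : Set ℕ} {n : ℤ} (hn : n ≤ 0) : SymExt H n ↔ n.natAbs ∉ H := by
  simp [SymExt, hn.not_gt]

theorem symExt_neg {H : Set ℕ} {n : ℤ} (hn : n ≠ 0) : SymExt H (-n) ↔ ¬ SymExt H n := by
  rcases lt_or_gt_of_ne hn with h | h
  · rw [symExt_of_pos (by omega), symExt_of_nonpos h.le, Int.natAbs_neg, not_not]
  · rw [symExt_of_pos h, symExt_of_nonpos (by omega), Int.natAbs_neg]

theorem BarClosed.symExt_sub {S : ℕ} {H : Set ℕ} (hH : BarClosed S H) {n : ℤ}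
    (h : SymExt H n) : SymExt H (n - S) := by
  rcases lt_or_ge 0 n with hn | hn
  · rw [symExt_of_pos hn] at h
    obtain ⟨h1, h2, h3⟩ := hH _ h
    rcases lt_or_ge (S : ℤ) n with hS | hS
    · rw [symExt_of_pos (by omega)]
      convert h2 (by omega) using 1
      omega
    · rw [symExt_of_nonpos (by omega)]
      convert h3 (by omega) using 2
      omega
  · rw [symExt_of_nonpos hn] at h
    rw [symExt_of_nonpos (by omega)]
    intro h'
    obtain ⟨h1, h2, -⟩ := hH _ h'
    rcases eq_or_ne n 0 with rfl | hn0
    · exact h1 (by omega)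
    · refine h ?_
      convert h2 (by omega) using 1
      omega

theorem BarClosed.symExt_sub_mul {S : ℕ} {H : Set ℕ} (hH : BarClosed S H) (k : ℕ)
    {n : ℤ} (h : SymExt H n) : SymExt H (n - k * S) := by
  induction k with
  | zero => simpa using h
  | succ k ih =>
    have := hH.symExt_sub ih
    convert this using 1
    push_cast
    ring

/-- The absolute values of the entries in the `p × q` rectangle of the array `d` that lie in
exactly one of `U` and the set of positive entries. -/
def trappedSet (p q : ℕ) (d : ℤ → ℤ → ℤ) (U : ℤ → ℤ → Prop) : Set ℕ :=
  {n | ∃ i j : ℤ, (0 ≤ i ∧ i < p) ∧ (0 ≤ j ∧ j < q) ∧ ¬ (U i j ↔ 0 < d i j) ∧ n = (d i j).natAbs}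

/-- A step along a row from a trapped entry either leads to an entry of the rectangle, or it leaves
the rectangle; in the latter case the new entry has the opposite sign, and its absolute value does
not occur in the rectangle. -/
theorem barClosed_trappedSet {p q S : ℕ} {d : ℤ → ℤ → ℤ} {U : ℤ → ℤ → Prop}
    (hd : ∀ i j : ℤ, d i (j + 1) = d i j - S)
    (hU : ∀ i j : ℤ, 0 ≤ i → i < p → 0 ≤ j → j + 1 < q → U i (j + 1) → U i j)
    (hneg : ∀ i : ℤ, 0 ≤ i → i < p → d i q < 0) (hpos : ∀ i : ℤ, 0 ≤ i → i < p → 0 < d i (-1))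
    (hne : ∀ i j : ℤ, 0 ≤ i → i < p → 0 ≤ j → j < q → d i j ≠ 0)
    (hinj : ∀ i j i' j' : ℤ, 0 ≤ i → i < p → -1 ≤ j → j ≤ q → 0 ≤ i' → i' < p → 0 ≤ j' → j' < q →
      (d i j).natAbs = (d i' j').natAbs → i = i' ∧ j = j') :
    BarClosed S (trappedSet p q d U) := by
  rintro h ⟨i, j, ⟨hi, hip⟩, ⟨hj, hjq⟩, ht, rfl⟩
  have h0 := hne i j hi hip hj hjq
  rcases lt_or_gt_of_ne h0 with hs | hs
  · -- `h = -d i j`, and `h - S` is the negative of the entry on the left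
    have hdj : d i j = d i (j - 1) - S := by rw [← hd, sub_add_cancel]
    have hUj : U i j := by
      by_contra hUj
      exact ht (iff_of_false hUj (by omega))
    rcases eq_or_lt_of_le hj with rfl | hj
    · have hp := hpos i hi hip
      rw [zero_sub] at hdj
      refine ⟨by omega, fun _ => by omega, fun _ => ?_⟩
      rintro ⟨i', j', ⟨hi', hip'⟩, ⟨hj', hjq'⟩, -, he⟩
      have := (hinj i (-1) i' j' hi hip le_rfl (by omega) hi' hip' hj' hjq' (by omega)).2
      omega
    · have hUj' : U i (j - 1) :=
        hU i (j - 1) hi hip (by omega) (by omega) (by rwa [sub_add_cancel])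
      have hne' := hne i (j - 1) hi hip (by omega) (by omega)
      refine ⟨by omega, fun _ => ⟨i, j - 1, ⟨hi, hip⟩, ⟨by omega, by omega⟩, ?_, by omega⟩,
        fun _ => ?_⟩
      · exact fun hh => absurd (hh.1 hUj') (by omega)
      · rintro ⟨i', j', ⟨hi', hip'⟩, ⟨hj', hjq'⟩, ht', he⟩
        obtain ⟨rfl, rfl⟩ := hinj i (j - 1) i' j' hi hip (by omega) (by omega) hi' hip' hj' hjq'
          (by omega)
        exact ht' (iff_of_true hUj' (by omega))
  · -- `h = d i j`, and `h - S` is the entry on the right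
    have hdj := hd i j
    have hUj : ¬ U i j := fun hUj => ht (iff_of_true hUj hs)
    rcases eq_or_lt_of_le (show j + 1 ≤ q by omega) with hj1 | hj1
    · have hp := hneg i hi hip
      rw [← hj1] at hp
      refine ⟨by omega, fun _ => by omega, fun _ => ?_⟩
      rintro ⟨i', j', ⟨hi', hip'⟩, ⟨hj', hjq'⟩, -, he⟩
      have := (hinj i (j + 1) i' j' hi hip (by omega) (by omega) hi' hip' hj' hjq' (by omega)).2
      omega
    · have hUj' : ¬ U i (j + 1) := fun hh => hUj (hU i j hi hip (by omega) hj1 hh)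
      have hne' := hne i (j + 1) hi hip (by omega) (by omega)
      refine ⟨by omega, fun _ => ⟨i, j + 1, ⟨hi, hip⟩, ⟨by omega, by omega⟩, ?_, by omega⟩,
        fun _ => ?_⟩
      · exact fun hh => absurd (hh.2 (by omega)) hUj'
      · rintro ⟨i', j', ⟨hi', hip'⟩, ⟨hj', hjq'⟩, ht', he⟩
        obtain ⟨rfl, rfl⟩ := hinj i (j + 1) i' j' hi hip (by omega) (by omega) hi' hip' hj' hjq'
          (by omega)
        exact ht' (iff_of_false hUj' (by omega))

/-- The properties of an array of integers, with steps `S` to the right and `T` down, from which it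
follows that the sets of values trapped between a path and the border of its `p × q` rectangle are
exactly the finite bar closed sets of positive integers with the property `adm`
(`IsTrapArray.range_trappedSet_side`). The injectivity of absolute values includes the boxes
adjacent to the sides of the rectangle. -/
structure IsTrapArray (p q S T : ℕ) (adm : ℕ → Prop) (d : ℤ → ℤ → ℤ) : Prop where
  right : ∀ i j : ℤ, d i (j + 1) = d i j - S
  down : ∀ i j : ℤ, d (i + 1) j = d i j - T
  right_neg : ∀ i : ℤ, 0 ≤ i → i < p → d i q < 0
  left_pos : ∀ i : ℤ, 0 ≤ i → i < p → 0 < d i (-1)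
  bottom_neg : ∀ j : ℤ, 0 ≤ j → j < q → d p j < 0
  top_pos : ∀ j : ℤ, 0 ≤ j → j < q → 0 < d (-1) j
  ne_zero : ∀ i j : ℤ, 0 ≤ i → i < p → 0 ≤ j → j < q → d i j ≠ 0
  inj_row : ∀ i j i' j' : ℤ, 0 ≤ i → i < p → -1 ≤ j → j ≤ q → 0 ≤ i' → i' < p → 0 ≤ j' → j' < q →
    (d i j).natAbs = (d i' j').natAbs → i = i' ∧ j = j'
  inj_col : ∀ i j i' j' : ℤ, -1 ≤ i → i ≤ p → 0 ≤ j → j < q → 0 ≤ i' → i' < p → 0 ≤ j' → j' < q →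
    (d i j).natAbs = (d i' j').natAbs → i = i' ∧ j = j'
  adm_entry : ∀ i j : ℤ, 0 ≤ i → i < p → 0 ≤ j → j < q → adm (d i j).natAbs
  exists_entry : ∀ H : Set ℕ, BarClosed S H → BarClosed T H → (∀ h ∈ H, 0 < h ∧ adm h) → ∀ h ∈ H,
    ∃ i j : ℤ, (0 ≤ i ∧ i < p) ∧ (0 ≤ j ∧ j < q) ∧ h = (d i j).natAbs

namespace IsTrapArray

variable {p q S T : ℕ} {adm : ℕ → Prop} {d : ℤ → ℤ → ℤ}

theorem antitone (hd : IsTrapArray p q S T adm d) {i j i' j' : ℤ} (hi : i' ≤ i) (hj : j' ≤ j) :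
    d i j ≤ d i' j' := by
  obtain ⟨a, rfl⟩ := Int.le.dest hi
  obtain ⟨b, rfl⟩ := Int.le.dest hj
  have h1 : ∀ (a : ℕ) j, d (i' + a) j ≤ d i' j := fun a j => by
    induction a with
    | zero => simp
    | succ a ih => push_cast; rw [← add_assoc, hd.down]; omega
  have h2 : ∀ (b : ℕ), d i' (j' + b) ≤ d i' j' := fun b => by
    induction b with
    | zero => simp
    | succ a ih => push_cast; rw [← add_assoc, hd.right]; omega
  exact (h1 a _).trans (h2 b)

/-- The side of a path, extended from the rectangle to integer coordinates. -/
def side (π : LatticePath p q) (i j : ℤ) : Prop := WordUpperLeft p π.1 i.toNat j.toNat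

theorem side_coe (π : LatticePath p q) (i : Fin p) (j : Fin q) :
    side π (i : ℕ) (j : ℕ) ↔ UpperLeft π i j := Iff.rfl

theorem exists_border (hd : IsTrapArray p q S T adm d) :
    ∃ β : LatticePath p q, IsBorder (fun (i : Fin p) (j : Fin q) => d (i : ℕ) (j : ℕ)) β := by
  obtain ⟨β, hβ⟩ := exists_latticePath (p := p) (q := q) (fun i j => 0 < d i j)
    fun i j i' j' _ _ hi hj h => h.trans_le (hd.antitone (by omega) (by omega))
  refine ⟨β, fun i j => ⟨(hβ i j).1, fun h => ?_⟩⟩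
  rw [hβ i j, not_lt] at h
  exact lt_of_le_of_ne h (hd.ne_zero i j (by omega) (by omega) (by omega) (by omega))

theorem trappedValues_eq (D : Fin p → Fin q → ℤ)
    (hD : D = fun (i : Fin p) (j : Fin q) => d (i : ℕ) (j : ℕ))
    {β : LatticePath p q} (hβ : IsBorder D β) (π : LatticePath p q) :
    trappedValues D π β = trappedSet p q d (side π) := by
  subst hD
  have key : ∀ i j, UpperLeft β i j ↔ 0 < d (i : ℕ) (j : ℕ) := fun i j =>
    ⟨(hβ i j).1, fun h => by_contra fun h' => absurd ((hβ i j).2 h') h.not_gt⟩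
  ext n
  constructor
  · rintro ⟨i, j, h, rfl⟩
    refine ⟨(i : ℕ), (j : ℕ), ⟨by omega, by omega⟩, ⟨by omega, by omega⟩, ?_, rfl⟩
    rwa [side_coe, ← key]
  · rintro ⟨i, j, ⟨hi, hip⟩, ⟨hj, hjq⟩, h, rfl⟩
    lift i to ℕ using hi
    lift j to ℕ using hj
    refine ⟨⟨i, by omega⟩, ⟨j, by omega⟩, ?_, rfl⟩
    rwa [key, ← side_coe]

theorem mem_trappedSet (hd : IsTrapArray p q S T adm d) (U : ℤ → ℤ → Prop) {i j : ℤ} (hi : 0 ≤ i)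
    (hip : i < p) (hj : 0 ≤ j) (hjq : j < q) :
    (d i j).natAbs ∈ trappedSet p q d U ↔ ¬ (U i j ↔ 0 < d i j) := by
  constructor
  · rintro ⟨i', j', ⟨hi', hip'⟩, ⟨hj', hjq'⟩, h, he⟩
    obtain ⟨rfl, rfl⟩ := hd.inj_row i j i' j' hi hip (by omega) (by omega) hi' hip' hj' hjq' he
    exact h
  · exact fun h => ⟨i, j, ⟨hi, hip⟩, ⟨hj, hjq⟩, h, rfl⟩

theorem trappedSet_side_injective (hd : IsTrapArray p q S T adm d) :
    Function.Injective fun π : LatticePath p q => trappedSet p q d (side π) := by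
  intro π π' h
  refine latticePath_ext fun i j => ?_
  have h1 := hd.mem_trappedSet (side π) (i := (i : ℕ)) (j := (j : ℕ)) (by omega) (by omega)
    (by omega) (by omega)
  have h2 := hd.mem_trappedSet (side π') (i := (i : ℕ)) (j := (j : ℕ)) (by omega) (by omega)
    (by omega) (by omega)
  dsimp only at h
  rw [h] at h1
  have h3 := not_iff_not.1 (h1.symm.trans h2)
  rw [side_coe, side_coe] at h3
  tauto

theorem finite_trappedSet (U : ℤ → ℤ → Prop) : (trappedSet p q d U).Finite := by
  refine (((Finset.Ico (0 : ℤ) p) ×ˢ (Finset.Ico (0 : ℤ) q)).finite_toSet.image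
    fun x => (d x.1 x.2).natAbs).subset ?_
  rintro n ⟨i, j, hi, hj, -, rfl⟩
  exact ⟨(i, j), by simpa using ⟨hi, hj⟩, rfl⟩

/-- The trapped sets of paths are exactly the bar closed sets of admissible numbers. A bar closed
set is recovered from the path whose upper left side consists of the entries outside its
antisymmetric extension. -/
theorem range_trappedSet_side (hd : IsTrapArray p q S T adm d) :
    Set.range (fun π : LatticePath p q => trappedSet p q d (side π)) =
      {H : Set ℕ | (H.Finite ∧ ∀ h ∈ H, 0 < h ∧ adm h) ∧ BarClosed S H ∧ BarClosed T H} := by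
  ext H
  constructor
  · rintro ⟨π, rfl⟩
    refine ⟨⟨finite_trappedSet _, ?_⟩, ?_, ?_⟩
    · rintro h ⟨i, j, ⟨hi, hip⟩, ⟨hj, hjq⟩, -, rfl⟩
      exact ⟨Int.natAbs_pos.2 (hd.ne_zero i j hi hip hj hjq), hd.adm_entry i j hi hip hj hjq⟩
    · exact barClosed_trappedSet hd.right
        (fun i j hi hip hj hjq h => WordUpperLeft.mono h le_rfl (by omega)) hd.right_neg
        hd.left_pos hd.ne_zero hd.inj_row
    · have hswap : trappedSet p q d (side π) =
          trappedSet q p (fun j i => d i j) (fun j i => side π i j) := by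
        ext n
        constructor
        · rintro ⟨i, j, hi, hj, h⟩
          exact ⟨j, i, hj, hi, h⟩
        · rintro ⟨j, i, hj, hi, h⟩
          exact ⟨i, j, hi, hj, h⟩
      simp only [hswap]
      refine barClosed_trappedSet (fun j i => hd.down i j)
        (fun j i hj hjq hi hip h => WordUpperLeft.mono h (by omega) le_rfl) hd.bottom_neg
        hd.top_pos (fun j i hj hjq hi hip => hd.ne_zero i j hi hip hj hjq) ?_
      intro j i j' i' hj hjq hi hip hj' hjq' hi' hip' he
      exact (hd.inj_col i j i' j' hi hip hj hjq hi' hip' hj' hjq' he).symm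
  · rintro ⟨⟨-, hadm⟩, hS, hT⟩
    have hMr : ∀ (i j : ℤ) (k : ℕ), SymExt H (d i j) → SymExt H (d i (j + k)) := fun i j k h => by
      induction k with
      | zero => simpa using h
      | succ k ih =>
        push_cast
        rw [← add_assoc, hd.right]
        exact hS.symExt_sub ih
    have hMd : ∀ (i j : ℤ) (k : ℕ), SymExt H (d i j) → SymExt H (d (i + k) j) := fun i j k h => by
      induction k with
      | zero => simpa using h
      | succ k ih =>
        push_cast
        rw [← add_assoc, hd.down]
        exact hT.symExt_sub ih
    obtain ⟨π, hπ⟩ := exists_latticePath (p := p) (q := q) (fun i j => ¬ SymExt H (d i j))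
      fun i j i' j' _ _ hi hj h h' => h <| by
        obtain ⟨a, rfl⟩ := Nat.exists_eq_add_of_le hi
        obtain ⟨b, rfl⟩ := Nat.exists_eq_add_of_le hj
        push_cast
        exact hMd _ _ _ (hMr _ _ _ h')
    refine ⟨π, ?_⟩
    -- an entry of the rectangle is trapped if and only if its absolute value belongs to `H`
    have key : ∀ i j : ℤ, 0 ≤ i → i < p → 0 ≤ j → j < q →
        (¬ (side π i j ↔ 0 < d i j) ↔ (d i j).natAbs ∈ H) := fun i j hi hip hj hjq => by
      lift i to ℕ using hi
      lift j to ℕ using hj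
      have h1 := hπ ⟨i, by omega⟩ ⟨j, by omega⟩
      rw [← side_coe] at h1
      simp only at h1
      rw [h1]
      rcases lt_or_ge 0 (d i j) with h | h
      · rw [symExt_of_pos h]
        tauto
      · rw [symExt_of_nonpos h]
        have := h.not_gt
        tauto
    ext h
    constructor
    · rintro ⟨i, j, ⟨hi, hip⟩, ⟨hj, hjq⟩, ht, rfl⟩
      exact (key i j hi hip hj hjq).1 ht
    · intro hh
      obtain ⟨i, j, ⟨hi, hip⟩, ⟨hj, hjq⟩, rfl⟩ := hd.exists_entry H hS hT hadm h hh
      exact ⟨i, j, ⟨hi, hip⟩, ⟨hj, hjq⟩, (key i j hi hip hj hjq).2 hh, rfl⟩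

end IsTrapArray

/-! ### Arithmetic of the two diagrams -/

/-- The entry in row `i` and column `j` of the diagonal hooks diagram (for `ε = 0`), and twice the
entry of the Yin-Yang diagram (for `ε = 1`), extended to integer coordinates. -/
def hookBarArray (s t : ℕ) (ε i j : ℤ) : ℤ := s * t - t * (2 * i + 1) - s * (2 * j + 1 + ε)

section HookBarArray

variable {s t p q : ℕ} {ε : ℤ}

theorem hookBarArray_right (i j : ℤ) :
    hookBarArray s t ε i (j + 1) = hookBarArray s t ε i j - (2 * s : ℕ) := by
  unfold hookBarArray
  push_cast
  ring

theorem hookBarArray_down (i j : ℤ) :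
    hookBarArray s t ε (i + 1) j = hookBarArray s t ε i j - (2 * t : ℕ) := by
  unfold hookBarArray
  push_cast
  ring

theorem hookBarArray_antitone {i j i' j' : ℤ} (hi : i' ≤ i) (hj : j' ≤ j) :
    hookBarArray s t ε i j ≤ hookBarArray s t ε i' j' := by
  unfold hookBarArray
  have h1 : (t : ℤ) * i' ≤ t * i := by gcongr
  have h2 : (s : ℤ) * j' ≤ s * j := by gcongr
  linarith

theorem hookBarArray_neg_of_right (hs : s = 2 * p + 1) (ht : t = 2 * q + 1) (hε : ε = 0 ∨ ε = 1)
    {i j : ℤ} (hi : 0 ≤ i) (hj : (q : ℤ) ≤ j) : hookBarArray s t ε i j < 0 := by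
  refine (hookBarArray_antitone hi hj).trans_lt ?_
  subst hs ht
  unfold hookBarArray
  rcases hε with rfl | rfl <;> push_cast <;> nlinarith

theorem hookBarArray_pos_of_left (hs : s = 2 * p + 1) (ht : t = 2 * q + 1) (hε : ε = 0 ∨ ε = 1)
    {i j : ℤ} (hi : i < p) (hj : j ≤ -1) : 0 < hookBarArray s t ε i j := by
  refine lt_of_lt_of_le ?_ (hookBarArray_antitone (show i ≤ p - 1 by omega) hj)
  subst hs ht
  unfold hookBarArray
  rcases hε with rfl | rfl <;> push_cast <;> nlinarith

theorem hookBarArray_neg_of_bottom (hs : s = 2 * p + 1) (ht : t = 2 * q + 1) (hε : ε = 0 ∨ ε = 1)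
    {i j : ℤ} (hi : (p : ℤ) ≤ i) (hj : 0 ≤ j) : hookBarArray s t ε i j < 0 := by
  refine (hookBarArray_antitone hi hj).trans_lt ?_
  subst hs ht
  unfold hookBarArray
  rcases hε with rfl | rfl <;> push_cast <;> nlinarith

theorem hookBarArray_pos_of_top (hs : s = 2 * p + 1) (ht : t = 2 * q + 1) (hε : ε = 0 ∨ ε = 1)
    {i j : ℤ} (hi : i ≤ -1) (hj : j < q) : 0 < hookBarArray s t ε i j := by
  refine lt_of_lt_of_le ?_ (hookBarArray_antitone hi (show j ≤ q - 1 by omega))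
  subst hs ht
  unfold hookBarArray
  rcases hε with rfl | rfl <;> push_cast <;> nlinarith

theorem hookBarArray_injective (hs : s = 2 * p + 1) (hst : s.Coprime t) {i j i' j' : ℤ}
    (hi : -1 ≤ i) (hip : i ≤ p) (hi' : 0 ≤ i') (hip' : i' < p)
    (h : hookBarArray s t ε i j = hookBarArray s t ε i' j') : i = i' ∧ j = j' := by
  unfold hookBarArray at h
  have h1 : (s : ℤ) ∣ i - i' := by
    refine (Nat.isCoprime_iff_coprime.2 hst).dvd_of_dvd_mul_left ⟨j' - j, ?_⟩
    linarith
  have h2 : i - i' = 0 := by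
    refine Int.eq_zero_of_abs_lt_dvd h1 ?_
    rw [abs_lt]
    omega
  have h3 : i = i' := by omega
  subst h3
  refine ⟨rfl, ?_⟩
  have : (s : ℤ) * j = s * j' := by linarith
  exact mul_left_cancel₀ (by omega) this

/-- Modulo the lattice of coordinates with equal entries, changing the sign is the rotation of the
array by 180 degrees, which moves the rectangle off itself. -/
theorem hookBarArray_ne_neg (hs : s = 2 * p + 1) (ht : t = 2 * q + 1) (hε : ε = 0 ∨ ε = 1)
    (hst : s.Coprime t) {i j i' j' : ℤ}
    (hi : -1 ≤ i) (hip : i ≤ p) (hij : i = -1 → j < q) (hi' : 0 ≤ i') (hip' : i' < p)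
    (hjq' : j' < q) :
    hookBarArray s t ε i j ≠ -hookBarArray s t ε i' j' := by
  intro h
  unfold hookBarArray at h
  have h1 : (s : ℤ) ∣ i + i' + 1 := by
    refine (Nat.isCoprime_iff_coprime.2 hst).dvd_of_dvd_mul_left
      ⟨t - j - j' - 1 - ε, ?_⟩
    linarith
  have h2 : i + i' + 1 = 0 := by
    refine Int.eq_zero_of_abs_lt_dvd h1 ?_
    rw [abs_lt]
    omega
  have h3 : i = -1 := by omega
  have h4 : i' = 0 := by omega
  subst h3 h4
  have h5 : (s : ℤ) * (t - j - j' - 1 - ε) = 0 := by linarith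
  rcases mul_eq_zero.1 h5 with h6 | h6
  · omega
  · have := hij rfl
    omega

theorem exists_hookBarArray_eq (hs : s = 2 * p + 1) (ht : t = 2 * q + 1) (hst : s.Coprime t)
    {n : ℤ} (hn : Even (n + 1 + ε)) :
    ∃ i j : ℤ, 0 ≤ i ∧ i < s ∧ n = hookBarArray s t ε i j := by
  have h1 : Even ((s : ℤ) * t - t - s - s * ε - n) := by
    subst hs ht
    have : ((2 * p + 1 : ℕ) : ℤ) * (2 * q + 1 : ℕ) - (2 * q + 1 : ℕ) - (2 * p + 1 : ℕ)
        - (2 * p + 1 : ℕ) * ε - n = 2 * (2 * p * q - p * ε) - (n + 1 + ε) := by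
      push_cast
      ring
    rw [this]
    exact (even_two_mul _).sub hn
  obtain ⟨N, hN⟩ := h1
  obtain ⟨a, b, hab⟩ := Nat.isCoprime_iff_coprime.2 hst
  have hs0 : (0 : ℤ) < s := by omega
  refine ⟨N * b % s, N * a + t * (N * b / s), Int.emod_nonneg _ hs0.ne', Int.emod_lt_of_pos _ hs0,
    ?_⟩
  unfold hookBarArray
  have h2 := Int.emod_add_mul_ediv (N * b) s
  have h3 : (t : ℤ) * (N * b % s) + s * (N * a + t * (N * b / s)) = N := by
    linear_combination (t : ℤ) * h2 + N * hab
  linarith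

/-- Let `M` be the antisymmetric extension of `H`. Outside the rectangle and its image under the
rotation by 180 degrees, `M` contains no positive number: its intersection with the multiples of
`s` and of `t` is determined, and it is closed under steps to the right and down. -/
theorem exists_natAbs_hookBarArray_eq (hs : s = 2 * p + 1) (ht : t = 2 * q + 1)
    (hε : ε = 0 ∨ ε = 1) (hst : s.Coprime t) {H : Set ℕ} (hS : BarClosed (2 * s) H)
    (hT : BarClosed (2 * t) H) {h : ℕ} (hh : h ∈ H) (h0 : 0 < h) (hpar : Even ((h : ℤ) + 1 + ε)) :
    ∃ i j : ℤ, (0 ≤ i ∧ i < p) ∧ (0 ≤ j ∧ j < q) ∧ h = (hookBarArray s t ε i j).natAbs := by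
  set e := hookBarArray s t ε with he
  have hM : ∀ {i j i' j' : ℤ}, i ≤ i' → j ≤ j' → SymExt H (e i j) → SymExt H (e i' j') := by
    intro i j i' j' hi hj h
    obtain ⟨a, rfl⟩ := Int.le.dest hi
    obtain ⟨b, rfl⟩ := Int.le.dest hj
    convert hT.symExt_sub_mul a (hS.symExt_sub_mul b h) using 1
    simp only [he, hookBarArray]
    push_cast
    ring
  have hsH : s ∉ H := fun hsH => (hS s hsH).2.2 (by omega) (by convert hsH using 1; omega)
  have htH : t ∉ H := fun htH => (hT t htH).2.2 (by omega) (by convert htH using 1; omega)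
  have hsH2 : 2 * s ∉ H := fun hsH => (hS _ hsH).1 rfl
  have htH2 : 2 * t ∉ H := fun htH => (hT _ htH).1 rfl
  have hs0 : 0 < s := by omega
  have ht0 : 0 < t := by omega
  have hnot : ∀ {n : ℕ}, 0 < n → n ∉ H → ¬ SymExt H n := fun hn hnH => by
    rw [symExt_of_pos (by omega)]
    simpa using hnH
  have hleft : ∀ i : ℤ, i < p → ¬ SymExt H (e i (-1)) := by
    intro i hi hMi
    rcases hε with rfl | rfl
    · refine hnot hs0 hsH ?_
      convert hM (show i ≤ p by omega) le_rfl hMi using 1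
      simp only [he, hookBarArray, hs]
      push_cast
      ring
    · refine hnot (by omega) htH2 ?_
      convert hM (show i ≤ p - 1 by omega) le_rfl hMi using 1
      simp only [he, hookBarArray, hs]
      push_cast
      ring
  have hright : SymExt H (e 0 q) := by
    rcases hε with rfl | rfl
    · have : e 0 q = -(t : ℤ) := by
        simp only [he, hookBarArray, ht]
        push_cast
        ring
      rw [this, symExt_neg (by omega)]
      exact hnot ht0 htH
    · have : e 0 q = -((s : ℤ) + t) := by
        simp only [he, hookBarArray, ht]
        push_cast
        ring
      rw [this, symExt_neg (by omega)]
      intro h1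
      have h2 := hT.symExt_sub (hS.symExt_sub h1)
      rw [show (s : ℤ) + t - (2 * s : ℕ) - (2 * t : ℕ) = -((s : ℤ) + t) by push_cast; ring,
        symExt_neg (by omega)] at h2
      exact h2 h1
  have hcol : ∀ j : ℤ, 0 < e p j → ¬ SymExt H (e p j) := by
    intro j hj hMj
    have h1 : e p j = -(s * (2 * j + 1 + ε)) := by
      simp only [he, hookBarArray, hs]
      push_cast
      ring
    have h2 : 2 * j + 1 + ε < 0 := by
      by_contra h2
      have : 0 ≤ (s : ℤ) * (2 * j + 1 + ε) := by
        have := not_lt.1 h2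
        positivity
      omega
    have h3 := hM le_rfl (show j ≤ -1 - ε by omega) hMj
    have h4 : e p (-1 - ε) = s * (1 + ε) := by
      simp only [he, hookBarArray, hs]
      push_cast
      ring
    rw [h4] at h3
    rcases hε with rfl | rfl
    · exact hnot hs0 hsH (by simpa using h3)
    · refine hnot (by omega) hsH2 ?_
      convert h3 using 1
      push_cast
      ring
  obtain ⟨i, j, hi, his, hij⟩ := exists_hookBarArray_eq (ε := ε) hs ht hst hpar
  rw [← he] at hij
  have hMh : SymExt H (e i j) := by
    rw [← hij, symExt_of_pos (by omega)]
    simpa using hh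
  rcases lt_trichotomy i p with hip | rfl | hip
  · have hj0 : 0 ≤ j := by
      by_contra hj
      exact hleft i hip (hM le_rfl (by omega) hMh)
    have hjq : j < q := by
      by_contra hj
      have : e i j < 0 := hookBarArray_neg_of_right hs ht hε hi (not_lt.1 hj)
      omega
    exact ⟨i, j, ⟨hi, hip⟩, ⟨hj0, hjq⟩, by omega⟩
  · exact absurd hMh (hcol j (by omega))
  · -- the rotation by 180 degrees moves the box into the rectangle
    have hrot : e (2 * p - i) (-j - 1 - ε) = -e i j := by
      simp only [he, hookBarArray, hs]
      push_cast
      ring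
    have hj0 : 0 ≤ -j - 1 - ε := by
      by_contra hj
      have : 0 < e (2 * p - i) (-j - 1 - ε) :=
        hookBarArray_pos_of_left hs ht hε (by omega) (by omega)
      omega
    have hjq : -j - 1 - ε < q := by
      by_contra hj
      have := hM (show 0 ≤ 2 * (p : ℤ) - i by omega) (not_lt.1 hj) hright
      rw [hrot, symExt_neg (by omega)] at this
      exact this hMh
    exact ⟨2 * p - i, -j - 1 - ε, ⟨by omega, by omega⟩, ⟨hj0, hjq⟩, by omega⟩

/-- Dividing `hookBarArray` by `k` gives a trap array. This is used with `k = 1` for the diagonal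
hooks diagram, whose entries are odd, and with `k = 2` for the Yin-Yang diagram. -/
theorem isTrapArray_of_mul_eq (hs : s = 2 * p + 1) (ht : t = 2 * q + 1) (hε : ε = 0 ∨ ε = 1)
    (hst : s.Coprime t) {k S T : ℕ} {adm : ℕ → Prop} {d : ℤ → ℤ → ℤ} (hk : 0 < k)
    (hd : ∀ i j, k * d i j = hookBarArray s t ε i j) (hS : k * S = 2 * s) (hT : k * T = 2 * t)
    (hadm : ∀ n : ℕ, adm n ↔ Even (((k * n : ℕ) : ℤ) + 1 + ε)) :
    IsTrapArray p q S T adm d := by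
  have hk' : (0 : ℤ) < k := by exact_mod_cast hk
  have hneg : ∀ {i j}, hookBarArray s t ε i j < 0 → d i j < 0 := fun {i j} h => by
    rw [← hd] at h
    exact (pos_iff_neg_of_mul_neg h).1 hk'
  have hpos : ∀ {i j}, 0 < hookBarArray s t ε i j → 0 < d i j := fun {i j} h => by
    rw [← hd] at h
    exact (pos_iff_pos_of_mul_pos h).1 hk'
  have hSz : (k : ℤ) * S = 2 * s := by exact_mod_cast hS
  have hTz : (k : ℤ) * T = 2 * t := by exact_mod_cast hT
  have hnat : ∀ i j, k * (d i j).natAbs = (hookBarArray s t ε i j).natAbs := fun i j => by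
    rw [← hd, Int.natAbs_mul, Int.natAbs_natCast]
  have hinj : ∀ i j i' j' : ℤ, -1 ≤ i → i ≤ p → (i = -1 → j < q) → 0 ≤ i' → i' < p → j' < q →
      (d i j).natAbs = (d i' j').natAbs → i = i' ∧ j = j' := by
    intro i j i' j' hi hip hij hi' hip' hjq' h
    have h1 : (hookBarArray s t ε i j).natAbs = (hookBarArray s t ε i' j').natAbs := by
      rw [← hnat, ← hnat, h]
    rcases Int.natAbs_eq_natAbs_iff.1 h1 with h2 | h2
    · exact hookBarArray_injective hs hst hi hip hi' hip' h2
    · exact absurd h2 (hookBarArray_ne_neg hs ht hε hst hi hip hij hi' hip' hjq')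
  refine ⟨fun i j => ?_, fun i j => ?_, fun i hi _ => hneg ?_, fun i _ hi => hpos ?_,
    fun j hj _ => hneg ?_, fun j _ hj => hpos ?_, ?_, ?_, ?_, ?_, ?_⟩
  · refine mul_left_cancel₀ hk'.ne' ?_
    rw [mul_sub, hd, hd, hSz, hookBarArray_right]
    push_cast
    rfl
  · refine mul_left_cancel₀ hk'.ne' ?_
    rw [mul_sub, hd, hd, hTz, hookBarArray_down]
    push_cast
    rfl
  · exact hookBarArray_neg_of_right hs ht hε hi le_rfl
  · exact hookBarArray_pos_of_left hs ht hε hi le_rfl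
  · exact hookBarArray_neg_of_bottom hs ht hε le_rfl hj
  · exact hookBarArray_pos_of_top hs ht hε le_rfl hj
  · intro i j hi hip hj hjq h
    refine hookBarArray_ne_neg hs ht hε hst (i := i) (j := j) (by omega) hip.le
      (by omega) hi hip hjq ?_
    rw [← hd, h]
    simp
  · intro i j i' j' hi hip _ _ hi' hip' _ hjq'
    exact hinj i j i' j' (by omega) hip.le (by omega) hi' hip' hjq'
  · intro i j i' j' hi hip _ hjq hi' hip' _ hjq'
    exact hinj i j i' j' hi hip (fun _ => hjq) hi' hip' hjq'
  · intro i j _ _ _ _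
    rw [hadm, hnat]
    have h1 : Even (hookBarArray s t ε i j + 1 + ε) := by
      refine ⟨2 * p * q - 2 * p * j - p * ε - 2 * q * i - i - j, ?_⟩
      simp only [hookBarArray, hs, ht]
      push_cast
      ring
    rw [Int.even_iff] at h1 ⊢
    omega
  · intro H hHS hHT hH h hh
    -- pass to the set of the `k`-fold multiples
    have himg : ∀ {A B : ℕ}, k * A = 2 * B → BarClosed A H →
        BarClosed (2 * B) ((fun n => k * n) '' H) := by
      rintro A B hAB hA _ ⟨n, hn, rfl⟩
      obtain ⟨h1, h2, h3⟩ := hA n hn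
      rw [← hAB]
      refine ⟨fun h => h1 (Nat.eq_of_mul_eq_mul_left hk h), fun h => ?_, fun h => ?_⟩
      · exact ⟨n - A, h2 (lt_of_mul_lt_mul_left h (Nat.zero_le k)), Nat.mul_sub k n A⟩
      · rintro ⟨m, hm, hm'⟩
        refine h3 (lt_of_mul_lt_mul_left h (Nat.zero_le k)) ?_
        have : m = A - n := by
          refine Nat.eq_of_mul_eq_mul_left hk ?_
          rw [Nat.mul_sub]
          exact hm'
        rwa [← this]
    obtain ⟨i, j, hi, hj, he⟩ := exists_natAbs_hookBarArray_eq (ε := ε) hs ht hε hst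
      (himg hS hHS) (himg hT hHT) ⟨h, hh, rfl⟩ (Nat.mul_pos hk (hH h hh).1)
      ((hadm h).1 (hH h hh).2)
    refine ⟨i, j, hi, hj, Nat.eq_of_mul_eq_mul_left hk ?_⟩
    rw [hnat]
    exact he

end HookBarArray

/-! ### Beads and hook lengths -/

namespace YoungDiagram

/-- The bead set (Maya diagram) of a partition, with one bead for each row, the empty rows included.
Its complement has one element for each column (`notMem_beads_iff`). -/
def beads (μ : YoungDiagram) : Set ℤ := Set.range fun i : ℕ => (μ.rowLen i : ℤ) - i - 1

theorem mem_iff_colLen_lt (μ : YoungDiagram) (i j : ℕ) :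
    (i, j) ∈ μ ↔ (j : ℤ) - μ.colLen j < μ.rowLen i - i - 1 := by
  have h1 : (i, j) ∈ μ ↔ j < μ.rowLen i := mem_iff_lt_rowLen
  have h2 : (i, j) ∈ μ ↔ i < μ.colLen j := mem_iff_lt_colLen
  by_cases h : (i, j) ∈ μ
  · have h3 := h1.1 h
    have h4 := h2.1 h
    exact iff_of_true h (by omega)
  · have h3 := mt h1.2 h
    have h4 := mt h2.2 h
    exact iff_of_false h (by omega)

theorem hookLength_cells (μ : YoungDiagram) {i j : ℕ} (h : (i, j) ∈ μ) :
    (hookLength μ.cells (i, j) : ℤ) = (μ.rowLen i - i - 1) - (j - μ.colLen j) := by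
  have h1 : j < μ.rowLen i := mem_iff_lt_rowLen.1 h
  have h2 : i < μ.colLen j := mem_iff_lt_colLen.1 h
  have h3 : (μ.cells.filter fun d => (d.1 = i ∧ j ≤ d.2) ∨ (d.2 = j ∧ i ≤ d.1)) =
      ({i} ×ˢ Finset.Ico j (μ.rowLen i)) ∪ (Finset.Ico (i + 1) (μ.colLen j) ×ˢ {j}) := by
    ext ⟨a, b⟩
    simp only [Finset.mem_filter, mem_cells, Finset.mem_union, Finset.mem_product,
      Finset.mem_singleton, Finset.mem_Ico]
    constructor
    · rintro ⟨hab, ⟨rfl, hb⟩ | ⟨rfl, ha⟩⟩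
      · exact Or.inl ⟨rfl, hb, mem_iff_lt_rowLen.1 hab⟩
      · rcases eq_or_lt_of_le ha with rfl | ha
        · exact Or.inl ⟨rfl, le_rfl, mem_iff_lt_rowLen.1 hab⟩
        · exact Or.inr ⟨⟨ha, mem_iff_lt_colLen.1 hab⟩, rfl⟩
    · rintro (⟨rfl, hb, hb'⟩ | ⟨⟨ha, ha'⟩, rfl⟩)
      · exact ⟨mem_iff_lt_rowLen.2 hb', Or.inl ⟨rfl, hb⟩⟩
      · exact ⟨mem_iff_lt_colLen.2 ha', Or.inr ⟨rfl, by omega⟩⟩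
  have h4 : Disjoint ({i} ×ˢ Finset.Ico j (μ.rowLen i))
      (Finset.Ico (i + 1) (μ.colLen j) ×ˢ {j}) := by
    rw [Finset.disjoint_left]
    rintro ⟨a, b⟩ h h'
    simp only [Finset.mem_product, Finset.mem_singleton, Finset.mem_Ico] at h h'
    omega
  unfold hookLength
  dsimp only
  rw [h3, Finset.card_union_of_disjoint h4]
  simp only [Finset.card_product, Finset.card_singleton, Nat.card_Ico]
  omega

theorem strictAnti_bead (μ : YoungDiagram) :
    StrictAnti fun i : ℕ => (μ.rowLen i : ℤ) - i - 1 := by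
  intro i k h
  have := μ.rowLen_anti i k h.le
  dsimp only
  omega

theorem notMem_beads_iff (μ : YoungDiagram) (z : ℤ) :
    z ∉ μ.beads ↔ ∃ j : ℕ, z = j - μ.colLen j := by
  constructor
  · intro hz
    have hex : ∃ i : ℕ, (μ.rowLen i : ℤ) - i - 1 < z := by
      refine ⟨μ.rowLen 0 + z.natAbs, ?_⟩
      have := μ.rowLen_anti 0 (μ.rowLen 0 + z.natAbs) (Nat.zero_le _)
      omega
    classical
    obtain ⟨i, hi, hmin⟩ : ∃ i : ℕ, (μ.rowLen i : ℤ) - i - 1 < z ∧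
        ∀ k < i, z < (μ.rowLen k : ℤ) - k - 1 := by
      refine ⟨Nat.find hex, Nat.find_spec hex, fun k hk => ?_⟩
      refine lt_of_le_of_ne (not_lt.1 (Nat.find_min hex hk)) ?_
      rintro rfl
      exact hz ⟨k, rfl⟩
    have hj : 0 ≤ z + i := by
      omega
    refine ⟨(z + i).toNat, ?_⟩
    have h1 : ¬ (i, (z + i).toNat) ∈ μ := by
      rw [mem_iff_lt_rowLen]
      omega
    rw [mem_iff_lt_colLen] at h1
    have h2 : i = 0 ∨ i - 1 < μ.colLen (z + i).toNat := by
      rcases Nat.eq_zero_or_pos i with h | h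
      · exact Or.inl h
      · right
        rw [← mem_iff_lt_colLen, mem_iff_lt_rowLen]
        have := hmin (i - 1) (by omega)
        omega
    omega
  · rintro ⟨j, rfl⟩ ⟨i, hi⟩
    dsimp only at hi
    have h1 := μ.mem_iff_colLen_lt i j
    have h2 : ¬ (i, j) ∈ μ := fun h => absurd (h1.1 h) (by omega)
    have h3 := mt mem_iff_lt_rowLen.2 h2
    have h4 := mt mem_iff_lt_colLen.2 h2
    omega

theorem isCorePartition_iff_beads {s : ℕ} (hs : 0 < s) (μ : YoungDiagram) :
    IsCorePartition s μ ↔ ∀ x ∈ μ.beads, x - s ∈ μ.beads := by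
  constructor
  · rintro h _ ⟨i, rfl⟩
    by_contra hx
    obtain ⟨j, hj⟩ := (μ.notMem_beads_iff _).1 hx
    dsimp only at hj
    have hij : (i, j) ∈ μ := (μ.mem_iff_colLen_lt i j).2 (by omega)
    have := μ.hookLength_cells hij
    exact h (i, j) hij (by omega)
  · rintro h ⟨i, j⟩ hij hs'
    have h1 := μ.hookLength_cells hij
    refine (μ.notMem_beads_iff _).2 ⟨j, rfl⟩ ?_
    convert h _ ⟨i, rfl⟩ using 1
    dsimp only
    omega

theorem colLen_eq_rowLen_of_transpose_eq {μ : YoungDiagram} (h : μ.transpose = μ) (i : ℕ) :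
    μ.colLen i = μ.rowLen i := by
  rw [← rowLen_transpose, h]

theorem notMem_beads_of_transpose_eq {μ : YoungDiagram} (h : μ.transpose = μ) (z : ℤ) :
    z ∉ μ.beads ↔ -1 - z ∈ μ.beads := by
  rw [notMem_beads_iff]
  simp only [colLen_eq_rowLen_of_transpose_eq h]
  refine exists_congr fun i => ?_
  dsimp only
  omega

theorem hookLength_diag {μ : YoungDiagram} (h : μ.transpose = μ) {i : ℕ} (hi : (i, i) ∈ μ) :
    (hookLength μ.cells (i, i) : ℤ) = 2 * (μ.rowLen i - i) - 1 := by
  rw [hookLength_cells _ hi, colLen_eq_rowLen_of_transpose_eq h]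
  ring

theorem mem_diagHookLengths_iff {μ : YoungDiagram} (h : μ.transpose = μ) (n : ℕ) :
    n ∈ diagHookLengths μ ↔ ∃ x ∈ μ.beads, 0 ≤ x ∧ (n : ℤ) = 2 * x + 1 := by
  constructor
  · rintro ⟨i, hi, rfl⟩
    refine ⟨_, ⟨i, rfl⟩, ?_, ?_⟩
    · have := mem_iff_lt_rowLen.1 hi
      dsimp only
      omega
    · rw [hookLength_diag h hi]
      dsimp only
      ring
  · rintro ⟨_, ⟨i, rfl⟩, hx, hn⟩
    dsimp only at hx hn
    have hi : (i, i) ∈ μ := mem_iff_lt_rowLen.2 (by omega)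
    refine ⟨i, hi, ?_⟩
    have := hookLength_diag h hi
    omega

theorem two_mul_add_one_mem_diagHookLengths {μ : YoungDiagram} (h : μ.transpose = μ) {x : ℤ}
    (hx : 0 ≤ x) : (2 * x + 1).toNat ∈ diagHookLengths μ ↔ x ∈ μ.beads := by
  rw [mem_diagHookLengths_iff h]
  constructor
  · rintro ⟨y, hy, hy0, he⟩
    rwa [show x = y by omega]
  · exact fun hx' => ⟨x, hx', hx, by omega⟩

/-- The beads determine the partition, and by symmetry the non-negative ones do; these are
given by the diagonal hook lengths. -/
theorem eq_of_diagHookLengths_eq {μ ν : YoungDiagram} (hμ : μ.transpose = μ)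
    (hν : ν.transpose = ν) (h : diagHookLengths μ = diagHookLengths ν) : μ = ν := by
  have h1 : μ.beads = ν.beads := by
    have h0 : ∀ x : ℤ, 0 ≤ x → (x ∈ μ.beads ↔ x ∈ ν.beads) := fun x hx => by
      rw [← two_mul_add_one_mem_diagHookLengths hμ hx, h,
        two_mul_add_one_mem_diagHookLengths hν hx]
    ext x
    rcases le_or_gt 0 x with hx | hx
    · exact h0 x hx
    · rw [← not_iff_not, notMem_beads_of_transpose_eq hμ, notMem_beads_of_transpose_eq hν]
      exact h0 _ (by omega)
  have h2 := (μ.strictAnti_bead.dual_right.range_inj ν.strictAnti_bead.dual_right).1 h1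
  refine SetLike.ext fun ⟨i, j⟩ => ?_
  rw [mem_iff_lt_rowLen, mem_iff_lt_rowLen]
  have : (μ.rowLen i : ℤ) - i - 1 = ν.rowLen i - i - 1 := congrFun h2 i
  omega

theorem isCorePartition_iff_barClosed {s : ℕ} (hs : 0 < s) {μ : YoungDiagram}
    (hμ : μ.transpose = μ) :
    IsCorePartition s μ ↔ BarClosed (2 * s) (diagHookLengths μ) := by
  rw [isCorePartition_iff_beads hs]
  have key : ∀ {x : ℤ}, 0 ≤ x → ((2 * x + 1).toNat ∈ diagHookLengths μ ↔ x ∈ μ.beads) :=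
    two_mul_add_one_mem_diagHookLengths hμ
  constructor
  · intro h n hn
    obtain ⟨x, hx, hx0, hnx⟩ := (mem_diagHookLengths_iff hμ n).1 hn
    refine ⟨by omega, fun hlt => ?_, fun hlt hmem => ?_⟩
    · convert (key (x := x - s) (by omega)).2 (h x hx) using 1
      omega
    · have h1 := (key (x := s - x - 1) (by omega)).1 (by convert hmem using 1; omega)
      refine (notMem_beads_of_transpose_eq hμ _).2 ?_ (h x hx)
      convert h1 using 1
      ring
  · intro h x hx
    rcases le_or_gt 0 x with hx0 | hx0
    · obtain ⟨-, h2, h3⟩ := h _ ((key hx0).2 hx)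
      rcases le_or_gt (s : ℤ) x with hxs | hxs
      · refine (key (by omega)).1 ?_
        convert h2 (by omega) using 1
        omega
      · by_contra hmem
        rw [notMem_beads_of_transpose_eq hμ, ← key (by omega)] at hmem
        refine h3 (by omega) ?_
        convert hmem using 1
        omega
    · by_contra hmem
      rw [notMem_beads_of_transpose_eq hμ, ← key (by omega)] at hmem
      obtain ⟨-, h2, -⟩ := h _ hmem
      refine (notMem_beads_of_transpose_eq hμ x).2 ?_ hx
      refine (key (by omega)).1 ?_
      convert h2 (by omega) using 1
      omega

end YoungDiagram

/-! ### Young diagrams with given arms and legs -/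

namespace YoungDiagram

/-- A sequence of natural numbers that decreases strictly until it reaches zero. -/
def IsStrictSeq (A : ℕ → ℕ) : Prop := ∀ i, A (i + 1) = 0 ∨ A (i + 1) < A i

theorem IsStrictSeq.add_le {A : ℕ → ℕ} (hA : IsStrictSeq A) {i k : ℕ} (hik : i ≤ k)
    (hk : A k ≠ 0) : A k + k ≤ A i + i := by
  induction k, hik using Nat.le_induction with
  | base => exact le_rfl
  | succ k _ ih =>
    have := (hA k).resolve_left hk
    have := ih (by omega)
    omega

theorem IsStrictSeq.ne_zero {A : ℕ → ℕ} (hA : IsStrictSeq A) {i k : ℕ} (hik : i ≤ k)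
    (hk : A k ≠ 0) : A i ≠ 0 := by
  have := hA.add_le hik hk
  omega

/-- The Young diagram with `A i` boxes weakly to the right of the diagonal in row `i`, and `B i`
boxes weakly below the diagonal in column `i`. (In Frobenius' notation, the arms and legs are
`A i - 1` and `B i - 1`.) -/
def frobenius (A B : ℕ → ℕ) (hA : IsStrictSeq A) (hB : IsStrictSeq B)
    (hAB : ∀ i, A i = 0 ↔ B i = 0) : YoungDiagram where
  cells := (Finset.range (A 0 + B 0) ×ˢ Finset.range (A 0 + B 0)).filter fun c =>
    (c.1 ≤ c.2 ∧ c.2 < A c.1 + c.1) ∨ (c.2 < c.1 ∧ c.1 < B c.2 + c.2)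
  isLowerSet := by
    rintro ⟨i, j⟩ ⟨i', j'⟩ ⟨hi, hj⟩ h
    simp only [Finset.coe_filter, Finset.mem_product, Finset.mem_range, Set.mem_ofPred_eq] at h ⊢
    dsimp only at hi hj
    refine ⟨⟨by omega, by omega⟩, ?_⟩
    rcases h with ⟨-, ⟨h1, h2⟩ | ⟨h1, h2⟩⟩
    · have hAi : A i ≠ 0 := by omega
      rcases le_or_gt i' j' with h3 | h3
      · have := hA.add_le hi hAi
        exact Or.inl ⟨h3, by omega⟩
      · have := hB.add_le (show j' ≤ i by omega) (mt (hAB i).2 hAi)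
        have := mt (hAB i).2 hAi
        exact Or.inr ⟨h3, by omega⟩
    · have hBj : B j ≠ 0 := by omega
      rcases le_or_gt i' j' with h3 | h3
      · have := hA.add_le (show i' ≤ j by omega) (mt (hAB j).1 hBj)
        have := mt (hAB j).1 hBj
        exact Or.inl ⟨h3, by omega⟩
      · have := hB.add_le hj hBj
        exact Or.inr ⟨h3, by omega⟩

section Frobenius

variable {A B : ℕ → ℕ} (hA : IsStrictSeq A) (hB : IsStrictSeq B) (hAB : ∀ i, A i = 0 ↔ B i = 0)

theorem mem_frobenius (i j : ℕ) : (i, j) ∈ frobenius A B hA hB hAB ↔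
    (i ≤ j ∧ j < A i + i) ∨ (j < i ∧ i < B j + j) := by
  rw [← mem_cells]
  simp only [frobenius, Finset.mem_filter, Finset.mem_product, Finset.mem_range,
    and_iff_right_iff_imp]
  rintro (⟨h1, h2⟩ | ⟨h1, h2⟩)
  · have := hA.add_le (Nat.zero_le i) (by omega)
    omega
  · have := hB.add_le (Nat.zero_le j) (by omega)
    omega

theorem diag_mem_frobenius (i : ℕ) : (i, i) ∈ frobenius A B hA hB hAB ↔ A i ≠ 0 := by
  rw [mem_frobenius]
  omega

theorem rowLen_frobenius {i : ℕ} (hi : A i ≠ 0) :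
    (frobenius A B hA hB hAB).rowLen i = A i + i := by
  refine eq_of_forall_lt_iff fun j => ?_
  rw [← mem_iff_lt_rowLen, mem_frobenius]
  rcases le_or_gt i j with h | h
  · omega
  · have := hB.add_le h.le (mt (hAB i).2 hi)
    have := mt (hAB i).2 hi
    omega

theorem colLen_frobenius {j : ℕ} (hj : A j ≠ 0) :
    (frobenius A B hA hB hAB).colLen j = B j + j := by
  refine eq_of_forall_lt_iff fun i => ?_
  rw [← mem_iff_lt_colLen, mem_frobenius]
  rcases le_or_gt i j with h | h
  · have := hA.add_le h hj
    have := mt (hAB j).2 hj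
    omega
  · omega

end Frobenius

/-! ### Partitions with distinct parts -/

theorem mem_partSet_iff (μ : YoungDiagram) (n : ℕ) :
    n ∈ partSet μ ↔ 0 < n ∧ ∃ i, μ.rowLen i = n := by
  simp only [partSet, rowLens, Set.mem_ofPred_eq, List.mem_map, List.mem_range,
    ← mem_iff_lt_colLen, mem_iff_lt_rowLen]
  constructor
  · rintro ⟨i, hi, rfl⟩
    exact ⟨hi, i, rfl⟩
  · rintro ⟨h, i, rfl⟩
    exact ⟨i, h, rfl⟩

theorem isStrictSeq_rowLen {μ : YoungDiagram} (h : IsBarPartition μ) : IsStrictSeq μ.rowLen := by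
  intro i
  by_contra! hi
  have hmem : ∀ k ≤ i + 1, k ∈ List.range (μ.colLen 0) := fun k hk => by
    rw [List.mem_range, ← mem_iff_lt_colLen, mem_iff_lt_rowLen]
    have := μ.rowLen_anti k (i + 1) hk
    omega
  have := List.inj_on_of_nodup_map h (hmem i (by omega)) (hmem (i + 1) le_rfl)
    (le_antisymm hi.2 (μ.rowLen_anti i (i + 1) (by omega)))
  omega

theorem eq_of_partSet_eq {μ ν : YoungDiagram} (hμ : IsBarPartition μ) (hν : IsBarPartition ν)
    (h : partSet μ = partSet ν) : μ = ν := by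
  refine equivListRowLens.injective (Subtype.ext ?_)
  exact ((List.perm_ext_iff_of_nodup hμ hν).2 fun n => Set.ext_iff.1 h n).eq_of_sortedGE
    μ.rowLens_sorted ν.rowLens_sorted

theorem exists_partSet_eq {H : Set ℕ} (hfin : H.Finite) (hpos : ∀ h ∈ H, 0 < h) :
    ∃ μ : YoungDiagram, IsBarPartition μ ∧ partSet μ = H := by
  have hrow : (ofRowLens _ hfin.toFinset.sortedGT_sort.sortedGE).rowLens =
      hfin.toFinset.sort (· ≥ ·) :=
    rowLens_ofRowLens_eq_self fun x hx => hpos x (by simpa using hx)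
  refine ⟨ofRowLens _ hfin.toFinset.sortedGT_sort.sortedGE, ?_, ?_⟩
  · rw [IsBarPartition, hrow]
    exact Finset.sort_nodup _ _
  · ext n
    rw [partSet, hrow]
    simp

/-! ### Bar lengths -/

/-- The number of boxes weakly to the right of the diagonal in row `i` of the shift-symmetric
diagram: the diagonal box itself belongs to the attached column. -/
def shiftedArm (μ : YoungDiagram) (i : ℕ) : ℕ := if μ.rowLen i = 0 then 0 else μ.rowLen i + 1

theorem shiftedArm_eq_zero_iff (μ : YoungDiagram) (i : ℕ) :
    shiftedArm μ i = 0 ↔ μ.rowLen i = 0 := by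
  unfold shiftedArm
  split_ifs with h <;> simp [h]

theorem isStrictSeq_shiftedArm {μ : YoungDiagram} (h : IsStrictSeq μ.rowLen) :
    IsStrictSeq (shiftedArm μ) := by
  intro i
  have := h i
  unfold shiftedArm
  split_ifs <;> omega

/-- The shift-symmetric diagram as a Young diagram. -/
def shiftSymmetricDiagram (μ : YoungDiagram) (h : IsStrictSeq μ.rowLen) : YoungDiagram :=
  frobenius (shiftedArm μ) μ.rowLen (isStrictSeq_shiftedArm h) h (shiftedArm_eq_zero_iff μ)

theorem cells_shiftSymmetricDiagram (μ : YoungDiagram) (h : IsStrictSeq μ.rowLen) :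
    (shiftSymmetricDiagram μ h).cells = shiftSymmetric μ := by
  ext ⟨a, b⟩
  rw [mem_cells, shiftSymmetricDiagram, mem_frobenius]
  simp only [shiftSymmetric, Finset.mem_union, Finset.mem_image, mem_cells, Prod.exists,
    Prod.mk.injEq, mem_iff_lt_rowLen]
  constructor
  · rintro (⟨h1, h2⟩ | ⟨h1, h2⟩)
    · unfold shiftedArm at h2
      split_ifs at h2 with h3
      · omega
      · rcases eq_or_lt_of_le h1 with rfl | h1
        · exact Or.inr ⟨a, 0, by omega, by omega, rfl⟩
        · exact Or.inl ⟨a, b - a - 1, by omega, rfl, by omega⟩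
    · exact Or.inr ⟨b, a - b, by omega, by omega, rfl⟩
  · rintro (⟨i, j, hj, rfl, rfl⟩ | ⟨i, j, hj, rfl, rfl⟩)
    · refine Or.inl ⟨by omega, ?_⟩
      rw [shiftedArm, if_neg (by omega)]
      omega
    · rcases Nat.eq_zero_or_pos j with rfl | h0
      · refine Or.inl ⟨by omega, ?_⟩
        rw [Nat.add_zero, shiftedArm, if_neg (by omega)]
        omega
      · exact Or.inr ⟨by omega, by omega⟩

section ShiftSymmetric

variable {μ : YoungDiagram}

theorem rowLen_shiftSymmetricDiagram (h : IsStrictSeq μ.rowLen) {i : ℕ} (hi : μ.rowLen i ≠ 0) :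
    (shiftSymmetricDiagram μ h).rowLen i = μ.rowLen i + 1 + i := by
  rw [shiftSymmetricDiagram, rowLen_frobenius _ _ _ (mt (shiftedArm_eq_zero_iff μ i).1 hi),
    shiftedArm, if_neg hi]

theorem colLen_shiftSymmetricDiagram (h : IsStrictSeq μ.rowLen) {i : ℕ} (hi : μ.rowLen i ≠ 0) :
    (shiftSymmetricDiagram μ h).colLen i = μ.rowLen i + i := by
  rw [shiftSymmetricDiagram, colLen_frobenius _ _ _ (mt (shiftedArm_eq_zero_iff μ i).1 hi)]

theorem diag_mem_shiftSymmetricDiagram (h : IsStrictSeq μ.rowLen) (i : ℕ) :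
    (i, i) ∈ shiftSymmetricDiagram μ h ↔ μ.rowLen i ≠ 0 := by
  rw [shiftSymmetricDiagram, diag_mem_frobenius, Ne, shiftedArm_eq_zero_iff]

theorem barLength_eq (h : IsStrictSeq μ.rowLen) {i j : ℕ} (hij : (i, j) ∈ μ) :
    (barLength μ (i, j) : ℤ) =
      μ.rowLen i - ((i + j + 1 : ℕ) - (shiftSymmetricDiagram μ h).colLen (i + j + 1)) := by
  have hj := mem_iff_lt_rowLen.1 hij
  have hrow := rowLen_shiftSymmetricDiagram h (i := i) (by omega)
  rw [barLength]
  dsimp only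
  rw [← cells_shiftSymmetricDiagram μ h, hookLength_cells, hrow]
  · push_cast
    ring
  · rw [mem_iff_lt_rowLen]
    omega

/-- The positive beads of the shift-symmetric diagram are the parts. -/
theorem mem_beads_shiftSymmetricDiagram (h : IsStrictSeq μ.rowLen) {n : ℕ} (hn : 0 < n) :
    (n : ℤ) ∈ (shiftSymmetricDiagram μ h).beads ↔ n ∈ partSet μ := by
  rw [mem_partSet_iff]
  constructor
  · rintro ⟨i, hi⟩
    dsimp only at hi
    have hdiag : (i, i) ∈ shiftSymmetricDiagram μ h := mem_iff_lt_rowLen.2 (by omega)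
    rw [rowLen_shiftSymmetricDiagram h ((diag_mem_shiftSymmetricDiagram h i).1 hdiag)] at hi
    exact ⟨hn, i, by omega⟩
  · rintro ⟨-, i, rfl⟩
    refine ⟨i, ?_⟩
    dsimp only
    rw [rowLen_shiftSymmetricDiagram h hn.ne']
    omega

/-- Zero is not a bead: the corresponding column is the one after the last diagonal box. -/
theorem zero_notMem_beads_shiftSymmetricDiagram (h : IsStrictSeq μ.rowLen) :
    (0 : ℤ) ∉ (shiftSymmetricDiagram μ h).beads := by
  rintro ⟨i, hi⟩
  dsimp only at hi
  have hdiag : (i, i) ∈ shiftSymmetricDiagram μ h := mem_iff_lt_rowLen.2 (by omega)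
  have hne := (diag_mem_shiftSymmetricDiagram h i).1 hdiag
  rw [rowLen_shiftSymmetricDiagram h hne] at hi
  omega

/-- In the row of a part `x`, every `z < x` outside the bead set with `0 ≤ z` yields the bar length
`x - z`: the column of `z` lies to the right of the diagonal. -/
theorem exists_barLength_eq (h : IsStrictSeq μ.rowLen) {i z : ℕ} (hz : z < μ.rowLen i)
    (hbead : (z : ℤ) ∉ (shiftSymmetricDiagram μ h).beads) :
    ∃ j, (i, j) ∈ μ ∧ barLength μ (i, j) = μ.rowLen i - z := by
  obtain ⟨b, hb⟩ := (notMem_beads_iff _ _).1 hbead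
  have hib : i < b := by
    by_contra hbi
    have := h.ne_zero (not_lt.1 hbi) (by omega)
    have := colLen_shiftSymmetricDiagram h this
    omega
  have hmem : (i, b) ∈ shiftSymmetricDiagram μ h := by
    rw [mem_iff_colLen_lt, rowLen_shiftSymmetricDiagram h (by omega)]
    omega
  rw [mem_iff_lt_rowLen, rowLen_shiftSymmetricDiagram h (by omega)] at hmem
  have hj : (i, b - i - 1) ∈ μ := mem_iff_lt_rowLen.2 (by omega)
  refine ⟨b - i - 1, hj, ?_⟩
  have := barLength_eq h hj
  rw [show i + (b - i - 1) + 1 = b by omega] at this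
  omega

theorem exists_barLength_eq_add (h : IsStrictSeq μ.rowLen) {i k : ℕ} (hik : i < k)
    (hk : μ.rowLen k ≠ 0) :
    ∃ j, (i, j) ∈ μ ∧ barLength μ (i, j) = μ.rowLen i + μ.rowLen k := by
  have := h.add_le hik.le hk
  have hj : (i, k - i - 1) ∈ μ := mem_iff_lt_rowLen.2 (by omega)
  refine ⟨k - i - 1, hj, ?_⟩
  have := barLength_eq h hj
  rw [show i + (k - i - 1) + 1 = k by omega, colLen_shiftSymmetricDiagram h hk] at this
  omega

theorem hasNoBar_iff_barClosed (h : IsStrictSeq μ.rowLen) {s : ℕ} (hs : Odd s) :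
    HasNoBar s μ ↔ BarClosed s (partSet μ) := by
  constructor
  · intro hbar x hx
    have hx' := hx
    rw [mem_partSet_iff] at hx'
    obtain ⟨hx0, i, rfl⟩ := hx'
    refine ⟨?_, fun hlt => ?_, fun hlt hmem => ?_⟩
    · rintro rfl
      obtain ⟨j, hj, he⟩ := exists_barLength_eq h (i := i) (z := 0) hx0
        (zero_notMem_beads_shiftSymmetricDiagram h)
      exact hbar _ hj (by simpa using he)
    · by_contra hmem
      obtain ⟨j, hj, he⟩ := exists_barLength_eq h (i := i) (z := μ.rowLen i - s)
        (by have := hs.pos; omega)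
        (by rwa [mem_beads_shiftSymmetricDiagram h (by omega)])
      exact hbar _ hj (by omega)
    · rw [mem_partSet_iff] at hmem
      obtain ⟨h0, k, hk⟩ := hmem
      rcases lt_trichotomy i k with hik | rfl | hik
      · obtain ⟨j, hj, he⟩ := exists_barLength_eq_add h hik (by omega)
        exact hbar _ hj (by omega)
      · -- the sum of two equal parts is even
        obtain ⟨r, hr⟩ := hs
        omega
      · obtain ⟨j, hj, he⟩ := exists_barLength_eq_add h hik (by omega)
        exact hbar _ hj (by omega)
  · rintro hH ⟨i, j⟩ hij he
    have hj := mem_iff_lt_rowLen.1 hij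
    have hlen := barLength_eq h hij
    obtain ⟨h1, h2, h3⟩ := hH (μ.rowLen i) ((mem_partSet_iff μ _).2 ⟨by omega, i, rfl⟩)
    have hbead := (notMem_beads_iff (shiftSymmetricDiagram μ h) _).2 ⟨i + j + 1, rfl⟩
    rcases lt_trichotomy (μ.rowLen i) s with hlt | heq | hlt
    · refine h3 hlt ((mem_partSet_iff μ _).2 ⟨by omega, i + j + 1, ?_⟩)
      have hdiag : (i + j + 1, i + j + 1) ∈ shiftSymmetricDiagram μ h :=
        mem_iff_lt_colLen.2 (by omega)
      have := colLen_shiftSymmetricDiagram h ((diag_mem_shiftSymmetricDiagram h _).1 hdiag)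
      omega
    · exact h1 heq
    · refine hbead ?_
      convert (mem_beads_shiftSymmetricDiagram h (by omega)).2 (h2 hlt) using 1
      omega

end ShiftSymmetric

/-! ### Self-conjugate partitions with given diagonal hook lengths -/

theorem exists_diagHookLengths_eq {H : Set ℕ} (hfin : H.Finite) (hodd : ∀ h ∈ H, Odd h) :
    ∃ μ : YoungDiagram, μ.transpose = μ ∧ diagHookLengths μ = H := by
  obtain ⟨ν, hν, hpart⟩ := exists_partSet_eq (hfin.image fun h => (h + 1) / 2) (by
    rintro _ ⟨h, hh, rfl⟩
    obtain ⟨r, rfl⟩ := hodd h hh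
    dsimp only
    omega)
  have hstr := isStrictSeq_rowLen hν
  have htr : (frobenius ν.rowLen ν.rowLen hstr hstr fun _ => Iff.rfl).transpose =
      frobenius ν.rowLen ν.rowLen hstr hstr fun _ => Iff.rfl := by
    refine SetLike.ext fun ⟨i, j⟩ => ?_
    rw [mem_transpose, Prod.swap_prod_mk, mem_frobenius, mem_frobenius]
    rcases lt_trichotomy i j with h | rfl | h <;> omega
  refine ⟨_, htr, ?_⟩
  ext n
  constructor
  · rintro ⟨i, hi, hn⟩
    have h1 := hookLength_diag htr hi
    rw [mem_cells, diag_mem_frobenius] at hi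
    rw [rowLen_frobenius _ _ _ hi] at h1
    have h2 : ν.rowLen i ∈ partSet ν := (mem_partSet_iff ν _).2 ⟨by omega, i, rfl⟩
    rw [hpart] at h2
    obtain ⟨m, hm, hm'⟩ := h2
    obtain ⟨r, rfl⟩ := hodd m hm
    dsimp only at hm'
    convert hm using 1
    omega
  · intro hn
    have h1 : (n + 1) / 2 ∈ partSet ν := by
      rw [hpart]
      exact ⟨n, hn, rfl⟩
    obtain ⟨h2, i, hi⟩ := (mem_partSet_iff ν _).1 h1
    have h3 := (diag_mem_frobenius hstr hstr (fun _ => Iff.rfl) i).2 (by omega)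
    have h4 := hookLength_diag htr h3
    rw [rowLen_frobenius _ _ _ (by omega)] at h4
    obtain ⟨r, rfl⟩ := hodd n hn
    exact ⟨i, h3, by omega⟩

end YoungDiagram

/-! ### Cores as bar closed sets -/

open YoungDiagram in
theorem selfConjCore_injective (s t : ℕ) :
    Function.Injective fun μ : SelfConjCore s t => diagHookLengths μ.1 :=
  fun μ ν h => Subtype.ext (eq_of_diagHookLengths_eq μ.2.1 ν.2.1 h)

open YoungDiagram in
theorem barCore_injective (s t : ℕ) : Function.Injective fun μ : BarCore s t => partSet μ.1 :=
  fun μ ν h => Subtype.ext (eq_of_partSet_eq μ.2.1 ν.2.1 h)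

open YoungDiagram in
theorem range_diagHookLengths {s t : ℕ} (hs : 0 < s) (ht : 0 < t) :
    Set.range (fun μ : SelfConjCore s t => diagHookLengths μ.1) =
      {H : Set ℕ | (H.Finite ∧ ∀ h ∈ H, 0 < h ∧ Odd h) ∧
        BarClosed (2 * s) H ∧ BarClosed (2 * t) H} := by
  ext H
  constructor
  · rintro ⟨⟨μ, hμ, h1, h2⟩, rfl⟩
    refine ⟨⟨?_, ?_⟩, (isCorePartition_iff_barClosed hs hμ).1 h1,
      (isCorePartition_iff_barClosed ht hμ).1 h2⟩
    · refine (μ.cells.finite_toSet.image (hookLength μ.cells)).subset ?_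
      rintro n ⟨i, hi, rfl⟩
      exact ⟨(i, i), hi, rfl⟩
    · intro n hn
      obtain ⟨x, -, hx, hn⟩ := (mem_diagHookLengths_iff hμ n).1 hn
      exact ⟨by omega, ⟨x.toNat, by omega⟩⟩
  · rintro ⟨⟨hfin, hH⟩, h1, h2⟩
    obtain ⟨μ, hμ, rfl⟩ := exists_diagHookLengths_eq hfin fun h hh => (hH h hh).2
    exact ⟨⟨μ, hμ, (isCorePartition_iff_barClosed hs hμ).2 h1,
      (isCorePartition_iff_barClosed ht hμ).2 h2⟩, rfl⟩

/-- The condition `True` gives the right-hand side the form of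
`IsTrapArray.range_trappedSet_side`. -/
theorem YoungDiagram.range_partSet {s t : ℕ} (hs : Odd s) (ht : Odd t) :
    Set.range (fun μ : BarCore s t => partSet μ.1) =
      {H : Set ℕ | (H.Finite ∧ ∀ h ∈ H, 0 < h ∧ True) ∧ BarClosed s H ∧ BarClosed t H} := by
  ext H
  constructor
  · rintro ⟨⟨μ, hμ, h1, h2⟩, rfl⟩
    refine ⟨⟨μ.rowLens.finite_toSet, fun n hn => ⟨μ.pos_of_mem_rowLens n hn, trivial⟩⟩,
      (hasNoBar_iff_barClosed (isStrictSeq_rowLen hμ) hs).1 h1,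
      (hasNoBar_iff_barClosed (isStrictSeq_rowLen hμ) ht).1 h2⟩
  · rintro ⟨⟨hfin, hH⟩, h1, h2⟩
    obtain ⟨μ, hμ, rfl⟩ := exists_partSet_eq hfin fun h hh => (hH h hh).1
    exact ⟨⟨μ, hμ, (hasNoBar_iff_barClosed (isStrictSeq_rowLen hμ) hs).2 h1,
      (hasNoBar_iff_barClosed (isStrictSeq_rowLen hμ) ht).2 h2⟩, rfl⟩

theorem exists_equiv_of_range_eq {α β γ : Type*} {f : α → γ} {g : β → γ}
    (hf : Function.Injective f) (hg : Function.Injective g) (h : Set.range f = Set.range g) :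
    ∃ e : α ≃ β, ∀ a, g (e a) = f a := by
  refine ⟨(Equiv.ofInjective f hf).trans ((Equiv.setCongr h).trans (Equiv.ofInjective g hg).symm),
    fun a => ?_⟩
  simp [Equiv.apply_ofInjective_symm hg]

/-! ### The diagonal hooks diagram and the Yin-Yang diagram -/

theorem isTrapArray_hook {s t : ℕ} (hs : Odd s) (ht : Odd t) (hst : s.Coprime t) :
    IsTrapArray (s / 2) (t / 2) (2 * s) (2 * t) Odd (hookBarArray s t 0) := by
  refine isTrapArray_of_mul_eq (k := 1) (ε := 0) ?_ ?_ (Or.inl rfl) hst one_pos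
    (fun i j => by simp) (one_mul _) (one_mul _) fun n => ?_
  · have := Nat.odd_iff.1 hs
    omega
  · have := Nat.odd_iff.1 ht
    omega
  · rw [Nat.odd_iff, Int.even_iff]
    omega

theorem isTrapArray_bar {s t : ℕ} (hs : Odd s) (ht : Odd t) (hst : s.Coprime t) :
    IsTrapArray (s / 2) (t / 2) s t (fun _ => True)
      (fun i j => t * ((s / 2 : ℕ) - i) - s * (j + 1)) := by
  have hs' : s = 2 * (s / 2) + 1 := by
    have := Nat.odd_iff.1 hs
    omega
  refine isTrapArray_of_mul_eq (k := 2) (ε := 1) hs' ?_ (Or.inr rfl) hst two_pos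
    (fun i j => ?_) rfl rfl fun n => ?_
  · have := Nat.odd_iff.1 ht
    omega
  · have : (s : ℤ) = 2 * (s / 2 : ℕ) + 1 := by exact_mod_cast hs'
    simp only [hookBarArray, Nat.cast_ofNat]
    linear_combination (-(t : ℤ)) * this
  · rw [Int.even_iff, true_iff]
    omega

theorem diagHooksDiagram_eq (s t : ℕ) :
    diagHooksDiagram s t =
      fun (i : Fin (s / 2)) (j : Fin (t / 2)) => hookBarArray s t 0 (i : ℕ) (j : ℕ) := by
  funext i j
  simp only [diagHooksDiagram, hookBarArray]
  ring

theorem yin_eq {s t : ℕ} (hs : Odd s) (i : Fin (s / 2)) (j : Fin (t / 2)) :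
    yin s t i j = t * ((s / 2 : ℕ) - ((i : ℕ) : ℤ)) - s * (((j : ℕ) : ℤ) + 1) := by
  have hs' : s = 2 * (s / 2) + 1 := by
    have := Nat.odd_iff.1 hs
    omega
  have h : (s : ℤ) = 2 * (s / 2 : ℕ) + 1 := by exact_mod_cast hs'
  simp only [yin, barPartArray]
  push_cast at h ⊢
  linear_combination (t : ℤ) * h

/-- The rotated Yang part is the negative of the Yin part. -/
theorem yang_eq_neg_yin {s t : ℕ} (hs : Odd s) (ht : Odd t) (i : Fin (s / 2)) (j : Fin (t / 2)) :
    yang s t i j = -yin s t i j := by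
  have hs' : s = 2 * (s / 2) + 1 := by
    have := Nat.odd_iff.1 hs
    omega
  have ht' : t = 2 * (t / 2) + 1 := by
    have := Nat.odd_iff.1 ht
    omega
  have h : (s : ℤ) = 2 * (s / 2 : ℕ) + 1 := by exact_mod_cast hs'
  have h' : (t : ℤ) = 2 * (t / 2 : ℕ) + 1 := by exact_mod_cast ht'
  have hi : ((i.rev : ℕ) : ℤ) = (s / 2 : ℕ) - 1 - (i : ℕ) := by
    rw [Fin.val_rev]
    omega
  have hj : ((j.rev : ℕ) : ℤ) = (t / 2 : ℕ) - 1 - (j : ℕ) := by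
    rw [Fin.val_rev]
    omega
  simp only [yang, yin, barPartArray]
  push_cast [hi, hj] at h h' ⊢
  linear_combination (t : ℤ) * h + (s : ℤ) * h'

theorem yinYangDiagram_eq {s t : ℕ} (hs : Odd s) (ht : Odd t) :
    yinYangDiagram s t =
      fun (i : Fin (s / 2)) (j : Fin (t / 2)) =>
        t * ((s / 2 : ℕ) - ((i : ℕ) : ℤ)) - s * (((j : ℕ) : ℤ) + 1) := by
  funext i j
  rw [← yin_eq hs, yinYangDiagram, yang_eq_neg_yin hs ht, neg_neg, ite_self]

/-! ### The bijections -/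

theorem theorem4p10 (s t : ℕ) (hs : 1 < s) (ht : 1 < t) (hs_odd : Odd s) (ht_odd : Odd t)
    (hst : Nat.Coprime s t) :
    ∃ βDH βYY : LatticePath (s / 2) (t / 2),
      IsBorder (diagHooksDiagram s t) βDH ∧
      IsBorder (yinYangDiagram s t) βYY ∧
      ∃ (Φ : LatticePath (s / 2) (t / 2) ≃ SelfConjCore s t)
        (Ψ : LatticePath (s / 2) (t / 2) ≃ BarCore s t)
        (γ : SelfConjCore s t ≃ BarCore s t),
        (∀ π, diagHookLengths (Φ π).1 = trappedValues (diagHooksDiagram s t) π βDH) ∧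
        (∀ π, partSet (Ψ π).1 = trappedValues (yinYangDiagram s t) π βYY) ∧
        (∀ π, γ (Φ π) = Ψ π) := by
  have hDH := isTrapArray_hook hs_odd ht_odd hst
  have hYY := isTrapArray_bar hs_odd ht_odd hst
  obtain ⟨βDH, hβDH⟩ := hDH.exists_border
  obtain ⟨βYY, hβYY⟩ := hYY.exists_border
  rw [← diagHooksDiagram_eq] at hβDH
  rw [← yinYangDiagram_eq hs_odd ht_odd] at hβYY
  obtain ⟨Φ, hΦ⟩ := exists_equiv_of_range_eq hDH.trappedSet_side_injective
    (selfConjCore_injective s t)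
    (hDH.range_trappedSet_side.trans (range_diagHookLengths (by omega) (by omega)).symm)
  obtain ⟨Ψ, hΨ⟩ := exists_equiv_of_range_eq hYY.trappedSet_side_injective
    (barCore_injective s t)
    (hYY.range_trappedSet_side.trans (YoungDiagram.range_partSet hs_odd ht_odd).symm)
  refine ⟨βDH, βYY, hβDH, hβYY, Φ, Ψ, Φ.symm.trans Ψ, fun π => ?_, fun π => ?_, fun π => ?_⟩
  · rw [IsTrapArray.trappedValues_eq _ (diagHooksDiagram_eq s t) hβDH]
    exact hΦ π
  · rw [IsTrapArray.trappedValues_eq (d := fun i j => t * ((s / 2 : ℕ) - i) - s * (j + 1)) _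
      (yinYangDiagram_eq hs_odd ht_odd) hβYY]
    exact hΨ π
  · simp
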